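/- Let $\Gamma_0$ be a triangle (three vertices, pairwise adjacent), and for $n\ge 0$ let $\Gamma_{n+1}$ be the graph obtained by partitioning an equilateral triangle into four smaller equilateral triangles and putting a copy of $\Gamma_n$ in each of the three corner triangles, so that any two of the copies share exactly one of their outmost vertices; the three corners of the large triangle are the outmost vertices of $\Gamma_{n+1}$. (Thus $\Gamma_1$ has $6$ vertices and $9$ edges.) A spanning $k$-forest of a graph is a spanning subgraph without cycles that has exactly $k$ connected components. Let $\tau(\Gamma_n)$ be the number of spanning trees of $\Gamma_n$; let $s(\Gamma_n)$ be the number of spanning $2$-forests of $\Gamma_n$ in which two fixed outmost vertices belong to the same connected component and the third outmost vertex belongs to the other component; and let $q(\Gamma_n)$ be the number of spanning $3$-forests of $\Gamma_n$ in which the three outmost vertices belong to three different connected components. Then for every $n\ge 1$, and for each choice of the two fixed outmost vertices in the definition of $s(\Gamma_n)$, $$\tau(\Gamma_n)=2^{\frac{3^n-1}{2}}\,3^{\frac{3^{n+1}+2n+1}{4}}\,5^{\frac{3^n-2n-1}{4}},$$ $$s(\Gamma_n)=2^{\frac{3^n-1}{2}}\,3^{\frac{3^{n+1}-2n-3}{4}}\,5^{\frac{3^n+2n-1}{4}},$$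 $$q(\Gamma_n)=2^{\frac{3^n-1}{2}}\,3^{\frac{3^{n+1}-6n-3}{4}}\,5^{\frac{3^n+6n-1}{4}}.$$ Moreover, the asymptotic growth constant of the spanning trees of $\Gamma_n$ is $$\lim_{n\to\infty}\frac{\log\tau(\Gamma_n)}{|V(\Gamma_n)|}=\frac13\log 2+\frac12\log 3+\frac16\log 5.$$ -/

import Mathlib

open Filter Topology

/-- Translation of the lattice `ℕ × ℕ` by the vector `v`. -/
def latticeShift (v : ℕ × ℕ) : (ℕ × ℕ) ↪ (ℕ × ℕ) := addRightEmbedding v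

/-- The vertices of the Sierpiński graph of level `n`, drawn in the triangular lattice: the point
`(x, y)` stands for `x • u + y • w`, where `u, w` are two unit vectors at angle `π / 3`.
The outer triangle of level `n` has the corners `(0, 0)`, `(2 ^ n, 0)`, `(0, 2 ^ n)`; level `n + 1`
consists of three copies of level `n`, one in each corner of the triangle of side `2 ^ (n + 1)`. -/
def sierpinskiVertices : ℕ → Finset (ℕ × ℕ)
  | 0 => {(0, 0), (1, 0), (0, 1)}
  | n + 1 => sierpinskiVertices n ∪ (sierpinskiVertices n).map (latticeShift (2 ^ n, 0)) ∪
      (sierpinskiVertices n).map (latticeShift (0, 2 ^ n))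

/-- The edges of the Sierpiński graph of level `n`, as a graph on all lattice points.
Level `0` is a single triangle; hence level `1` is the graph with 6 vertices and 9 edges made of
three triangles which pairwise share a vertex. -/
def sierpinskiLattice : ℕ → SimpleGraph (ℕ × ℕ)
  | 0 => SimpleGraph.fromEdgeSet
      {s((0, 0), (1, 0)), s((1, 0), (0, 1)), s((0, 1), (0, 0))}
  | n + 1 => sierpinskiLattice n ⊔ (sierpinskiLattice n).map (latticeShift (2 ^ n, 0)) ⊔
      (sierpinskiLattice n).map (latticeShift (0, 2 ^ n))

/-- The Sierpiński graph `Γ_n`. -/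
def sierpinskiGraph (n : ℕ) : SimpleGraph {p : ℕ × ℕ // p ∈ sierpinskiVertices n} :=
  (sierpinskiLattice n).comap Subtype.val

/-- The coordinates of the three outmost vertices of `Γ_n`. -/
def sierpinskiCornerPoint (n : ℕ) : Fin 3 → ℕ × ℕ :=
  ![(0, 0), (2 ^ n, 0), (0, 2 ^ n)]

theorem sierpinskiCornerPoint_mem (n : ℕ) (i : Fin 3) :
    sierpinskiCornerPoint n i ∈ sierpinskiVertices n := by
  induction n generalizing i with
  | zero => fin_cases i <;> simp [sierpinskiCornerPoint, sierpinskiVertices]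
  | succ n ih =>
    have h0 := ih 0
    have h1 := ih 1
    have h2 := ih 2
    simp only [sierpinskiCornerPoint, Matrix.cons_val] at h0 h1 h2
    fin_cases i
    · simp [sierpinskiCornerPoint, sierpinskiVertices, h0]
    · simp only [sierpinskiCornerPoint, sierpinskiVertices, Finset.mem_union, Finset.mem_map]
      exact Or.inl (Or.inr ⟨_, h1, by simp [latticeShift, pow_succ, mul_two]⟩)
    · simp only [sierpinskiCornerPoint, sierpinskiVertices, Finset.mem_union, Finset.mem_map]
      exact Or.inr ⟨_, h2, by simp [latticeShift, pow_succ, mul_two]⟩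

/-- The three outmost vertices of `Γ_n`. -/
def sierpinskiCorner (n : ℕ) (i : Fin 3) : {p : ℕ × ℕ // p ∈ sierpinskiVertices n} :=
  ⟨sierpinskiCornerPoint n i, sierpinskiCornerPoint_mem n i⟩

/-- The complexity `τ(G)`: the number of spanning trees of `G`, that is, of trees `H` on the full
vertex set of `G` all of whose edges are edges of `G`. -/
noncomputable def numSpanningTrees {V : Type*} (G : SimpleGraph V) : ℕ :=
  {H : SimpleGraph V | H ≤ G ∧ H.IsTree}.ncard

/-- `H` is a spanning `k`-forest of `G`: a spanning subgraph without cycles, with exactly `k`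
connected components. -/
def IsSpanningForest {V : Type*} (G : SimpleGraph V) (k : ℕ) (H : SimpleGraph V) : Prop :=
  H ≤ G ∧ H.IsAcyclic ∧ ENat.card H.ConnectedComponent = k

/-- The number `s(Γ_n)` of spanning `2`-forests of `Γ_n` in which the outmost vertices numbered
`i` and `j` lie in the same component and the outmost vertex numbered `k` lies in the other one. -/
noncomputable def sierpinskiTwoForests (n : ℕ) (i j k : Fin 3) : ℕ :=
  {H | IsSpanningForest (sierpinskiGraph n) 2 H ∧
    H.Reachable (sierpinskiCorner n i) (sierpinskiCorner n j) ∧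
    ¬ H.Reachable (sierpinskiCorner n i) (sierpinskiCorner n k)}.ncard

/-- The number `q(Γ_n)` of spanning `3`-forests of `Γ_n` in which the three outmost vertices lie in
three different components. -/
noncomputable def sierpinskiThreeForests (n : ℕ) : ℕ :=
  {H | IsSpanningForest (sierpinskiGraph n) 3 H ∧
    ∀ i j : Fin 3, i ≠ j →
      ¬ H.Reachable (sierpinskiCorner n i) (sierpinskiCorner n j)}.ncard

/-! The graph of level `n + 1` consists of three copies of level `n`, any two sharing one corner.
Consider forests all of whose components meet the outmost vertices. Such a forest induces one of
five partitions of the three corners, its corner type, and restricts to a forest of the same kind on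
each copy. Conversely, whether three such pieces glue to a forest of a given type depends only on
their types. Connectivity between corners is generated by the partitions and the shared points.
Acyclicity is decided by the count edges + components = vertices (`isAcyclic_iff_card`,
`hasCornerType_glueGraph_iff`). So `numCornerForests_glueGraph` reduces the recursion to finitely
many triples of types.

Write `τ`, `s`, `q` for the numbers of forests of level `n` whose type has one, two, three classes.
Counting the triples gives `τ' = 6τ²s`, `s' = τ²q + 7τs²`, `q' = 12τsq + 14s³`, starting from `3, 1,
1`. The relation `τq = 3s²` collapses the last two to `s' = 10τs²` and `q' = 50s³`, so only the
primes 2, 3, 5 occur and the exponents satisfy linear recursions. The growth constant follows from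
`2|V| = 3 ^ (n + 1) + 3`. -/

/-! ### Edge and component counts of forests -/

namespace SimpleGraph

variable {V : Type*}

/-- Reachability after adding an edge. -/
theorem Reachable.of_sup_edge {G : SimpleGraph V} {u v x y : V} (h : (G ⊔ edge u v).Reachable x y) :
    G.Reachable x y ∨ (G.Reachable x u ∧ G.Reachable v y) ∨
      (G.Reachable x v ∧ G.Reachable u y) := by
  obtain ⟨p⟩ := h
  induction p with
  | nil => exact Or.inl (Reachable.refl _)
  | cons hadj _ ih =>
    rw [sup_adj, edge_adj] at hadj
    rcases hadj with hadj | ⟨⟨rfl, rfl⟩ | ⟨rfl, rfl⟩, -⟩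
    · have hr := hadj.reachable
      rcases ih with ih | ⟨h1, h2⟩ | ⟨h1, h2⟩
      · exact Or.inl (hr.trans ih)
      · exact Or.inr (Or.inl ⟨hr.trans h1, h2⟩)
      · exact Or.inr (Or.inr ⟨hr.trans h1, h2⟩)
    · rcases ih with ih | ⟨_, h2⟩ | ⟨_, h2⟩
      · exact Or.inr (Or.inl ⟨Reachable.refl _, ih⟩)
      · exact Or.inr (Or.inl ⟨Reachable.refl _, h2⟩)
      · exact Or.inl h2
    · rcases ih with ih | ⟨_, h2⟩ | ⟨_, h2⟩
      · exact Or.inr (Or.inr ⟨Reachable.refl _, ih⟩)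
      · exact Or.inl h2
      · exact Or.inr (Or.inr ⟨Reachable.refl _, h2⟩)

/-- Joining two distinct components by an edge lowers the number of components by one. -/
theorem card_connectedComponent_sup_edge [Finite V] {G : SimpleGraph V} {u v : V}
    (h : ¬ G.Reachable u v) :
    Nat.card (G ⊔ edge u v).ConnectedComponent + 1 = Nat.card G.ConnectedComponent := by
  classical
  have huv : u ≠ v := fun e => h (e ▸ Reachable.refl _)
  have hadj : (G ⊔ edge u v).Adj u v := by simp [edge_adj, huv]
  -- The component of `v` is absorbed by that of `u`; all others survive unchanged.
  let f : {c : G.ConnectedComponent // c ≠ G.connectedComponentMk v} →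
      (G ⊔ edge u v).ConnectedComponent := fun c => c.1.map (Hom.ofLE le_sup_left)
  have hf : Function.Bijective f := by
    constructor
    · rintro ⟨c, hc⟩ ⟨d, hd⟩ hcd
      induction c using ConnectedComponent.ind with | _ x
      induction d using ConnectedComponent.ind with | _ y
      have hxy : (G ⊔ edge u v).Reachable x y := ConnectedComponent.exact hcd
      rw [Ne, ConnectedComponent.eq] at hc hd
      refine Subtype.ext (ConnectedComponent.sound ?_)
      rcases hxy.of_sup_edge with h1 | ⟨_, h2⟩ | ⟨h1, _⟩
      · exact h1
      · exact absurd h2.symm hd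
      · exact absurd h1 hc
    · intro c
      induction c using ConnectedComponent.ind with | _ x
      by_cases hx : G.Reachable x v
      · refine ⟨⟨G.connectedComponentMk u, fun e => h (ConnectedComponent.exact e)⟩, ?_⟩
        exact ConnectedComponent.sound (hadj.reachable.trans (hx.symm.mono le_sup_left))
      · exact ⟨⟨G.connectedComponentMk x, fun e => hx (ConnectedComponent.exact e)⟩, rfl⟩
  rw [← Nat.card_congr (Equiv.ofBijective f hf)]
  have := Fintype.ofFinite G.ConnectedComponent
  have hpos : 0 < Fintype.card G.ConnectedComponent :=
    Fintype.card_pos_iff.2 ⟨G.connectedComponentMk v⟩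
  rw [Nat.card_eq_fintype_card, Nat.card_eq_fintype_card]
  have := Fintype.card_subtype_compl (fun c : G.ConnectedComponent => c = G.connectedComponentMk v)
  rw [Fintype.card_subtype_eq] at this
  simp only [ne_eq]
  omega

theorem edgeSet_ncard_sup_edge [Finite V] {G : SimpleGraph V} {u v : V} (huv : u ≠ v)
    (h : ¬ G.Adj u v) : (G ⊔ edge u v).edgeSet.ncard = G.edgeSet.ncard + 1 := by
  rw [edgeSet_sup, edgeSet_edge_of_ne huv, Set.union_singleton,
    Set.ncard_insert_of_notMem (by simpa using h) (Set.toFinite _)]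

/-- Induction on the edges. Restoring a removed edge keeps edges + components constant if it joins
two components, and raises the sum by one if it closes a cycle. The inequality is carried along
because it is what rules out equality in the second case. -/
theorem card_le_and_isAcyclic_iff [Finite V] (G : SimpleGraph V) :
    Nat.card V ≤ G.edgeSet.ncard + Nat.card G.ConnectedComponent ∧
      (G.IsAcyclic ↔ G.edgeSet.ncard + Nat.card G.ConnectedComponent = Nat.card V) := by
  induction hm : G.edgeSet.ncard generalizing G with
  | zero =>
    rw [Set.ncard_eq_zero (Set.toFinite _), edgeSet_eq_empty] at hm
    subst hm
    have : Nat.card (⊥ : SimpleGraph V).ConnectedComponent = Nat.card V := by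
      refine (Nat.card_congr (Equiv.ofBijective (connectedComponentMk _) ⟨fun x y hxy => ?_,
        Quot.mk_surjective⟩)).symm
      simpa using hxy
    simp [this]
  | succ m ih =>
    have hne : G.edgeSet.Nonempty := Set.nonempty_of_ncard_ne_zero (by omega)
    obtain ⟨e, he⟩ := hne
    induction e using Sym2.ind with | _ u v
    rw [mem_edgeSet] at he
    have hG : (G.deleteEdges {s(u, v)}) ⊔ edge u v = G := by
      ext x y
      simp only [sup_adj, deleteEdges_adj, edge_adj, Set.mem_singleton_iff, Sym2.eq_iff]
      constructor
      · rintro (h | ⟨⟨rfl, rfl⟩ | ⟨rfl, rfl⟩, -⟩)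
        exacts [h.1, he, he.symm]
      · intro h
        have := h.ne
        tauto
    set F := G.deleteEdges {s(u, v)} with hF
    have hnadj : ¬ F.Adj u v := by simp [hF]
    have hcard := edgeSet_ncard_sup_edge he.ne hnadj
    rw [hG, hm] at hcard
    obtain ⟨ih1, ih2⟩ := ih F (by omega)
    have hb : G.IsAcyclic ↔ F.IsAcyclic ∧ (F.Reachable u v → u = v ∨ F.Adj u v) := by
      have : (F ⊔ edge u v).IsAcyclic ↔ _ := isAcyclic_sup_fromEdgeSet_iff
      rwa [hG] at this
    by_cases hr : F.Reachable u v
    · have hc : Nat.card G.ConnectedComponent = Nat.card F.ConnectedComponent := by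
        refine (Nat.card_congr (Equiv.ofBijective
          (fun c => c.map (Hom.ofLE (hG ▸ le_sup_left : F ≤ G))) ⟨?_, ?_⟩)).symm
        · intro c d hcd
          induction c using ConnectedComponent.ind with | _ x
          induction d using ConnectedComponent.ind with | _ y
          have hxy : (F ⊔ edge u v).Reachable x y := hG.symm ▸ ConnectedComponent.exact hcd
          refine ConnectedComponent.sound ?_
          rcases hxy.of_sup_edge with h1 | ⟨h1, h2⟩ | ⟨h1, h2⟩
          · exact h1
          · exact (h1.trans hr).trans h2
          · exact (h1.trans hr.symm).trans h2
        · exact ConnectedComponent.surjective_map_ofLE _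
      refine ⟨by omega, ⟨fun h => ?_, fun h => by omega⟩⟩
      rcases (hb.1 h).2 hr with h | h
      exacts [absurd h he.ne, absurd h hnadj]
    · have hc := card_connectedComponent_sup_edge hr
      rw [hG] at hc
      refine ⟨by omega, ?_⟩
      rw [hb, ih2]
      constructor
      · rintro ⟨h, -⟩; omega
      · intro h; exact ⟨by omega, fun h => absurd h hr⟩

/-- A finite graph is a forest iff its numbers of edges and of components add up to the number of
vertices. -/
theorem isAcyclic_iff_card [Finite V] (G : SimpleGraph V) :
    G.IsAcyclic ↔ G.edgeSet.ncard + Nat.card G.ConnectedComponent = Nat.card V :=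
  (card_le_and_isAcyclic_iff G).2

end SimpleGraph

/-! ### Corner partitions and corner types of forests -/

section CornerType

/-- The five partitions of the three corners, as labellings of the corners: `0` has one class,
`k + 1` has the classes `{k}` and its complement (`k = 0, 1, 2`), and `4` has three classes. -/
def cornerLabel : Fin 5 → Fin 3 → Fin 3 :=
  ![![0, 0, 0], ![0, 1, 1], ![0, 1, 0], ![0, 0, 1], ![0, 1, 2]]

/-- The number of classes of a partition of the corners. -/
def numClasses : Fin 5 → ℕ := ![1, 2, 2, 2, 3]

/-- Of the eight truth patterns for the pairs 01, 02, 12, transitivity excludes the three in which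
exactly two pairs are related; the other five are the partitions. -/
theorem exists_cornerLabel {r : Fin 3 → Fin 3 → Prop} (hr : Equivalence r) :
    ∃ t, ∀ i j, r i j ↔ cornerLabel t i = cornerLabel t j := by
  have h01 := fun h => hr.symm (x := 0) (y := 1) h
  have h10 := fun h => hr.symm (x := 1) (y := 0) h
  have h02 := fun h => hr.symm (x := 0) (y := 2) h
  have h20 := fun h => hr.symm (x := 2) (y := 0) h
  have h12 := fun h => hr.symm (x := 1) (y := 2) h
  have h21 := fun h => hr.symm (x := 2) (y := 1) h
  have t1 := fun h h' => hr.trans (x := 0) (y := 1) (z := 2) h h'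
  have t2 := fun h h' => hr.trans (x := 0) (y := 2) (z := 1) h h'
  have t3 := fun h h' => hr.trans (x := 1) (y := 0) (z := 2) h h'
  have r0 := hr.refl 0
  have r1 := hr.refl 1
  have r2 := hr.refl 2
  by_cases a : r 0 1 <;> by_cases b : r 0 2 <;> by_cases c : r 1 2
  · exact ⟨0, by simp [Fin.forall_fin_succ, cornerLabel, *]⟩
  · exact absurd (t3 (h01 a) b) c
  · exact absurd (t1 a c) b
  · exact ⟨3, by simp [Fin.forall_fin_succ, cornerLabel, *]; tauto⟩
  · exact absurd (t2 b (h12 c)) a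
  · exact ⟨2, by simp [Fin.forall_fin_succ, cornerLabel, *]; tauto⟩
  · exact ⟨1, by simp [Fin.forall_fin_succ, cornerLabel, *]; tauto⟩
  · exact ⟨4, by simp [Fin.forall_fin_succ, cornerLabel, *]; tauto⟩

theorem cornerLabel_unique {s t : Fin 5}
    (h : ∀ i j, cornerLabel s i = cornerLabel s j ↔ cornerLabel t i = cornerLabel t j) :
    s = t := by
  revert s t
  decide

theorem ncard_range_cornerLabel (t : Fin 5) : (Set.range (cornerLabel t)).ncard = numClasses t := by
  rw [← Set.image_univ, ← Finset.coe_univ, ← Finset.coe_image, Set.ncard_coe_finset]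
  revert t
  decide

/-- `H` is a forest all of whose components meet the corners `b`, and which induces on them the
partition numbered `t`. -/
structure HasCornerType {V : Type*} (b : Fin 3 → V) (H : SimpleGraph V) (t : Fin 5) : Prop where
  isAcyclic : H.IsAcyclic
  exists_reachable : ∀ v, ∃ i, H.Reachable v (b i)
  reachable_iff : ∀ i j, H.Reachable (b i) (b j) ↔ cornerLabel t i = cornerLabel t j

/-- Acyclicity is deliberately not assumed: this count is used to prove it, through
`isAcyclic_iff_card`. -/
theorem card_connectedComponent_of_corners {V : Type*} {b : Fin 3 → V} {H : SimpleGraph V}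
    {t : Fin 5} (h1 : ∀ v, ∃ i, H.Reachable v (b i))
    (h2 : ∀ i j, H.Reachable (b i) (b j) ↔ cornerLabel t i = cornerLabel t j) :
    Nat.card H.ConnectedComponent = numClasses t := by
  have hs : Function.Surjective fun i => H.connectedComponentMk (b i) := by
    intro c
    induction c using SimpleGraph.ConnectedComponent.ind with | _ x
    obtain ⟨i, hi⟩ := h1 x
    exact ⟨i, SimpleGraph.ConnectedComponent.sound hi.symm⟩
  have hk : Setoid.ker (fun i => H.connectedComponentMk (b i)) = Setoid.ker (cornerLabel t) := by
    ext i j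
    simp only [Setoid.ker_def, SimpleGraph.ConnectedComponent.eq]
    exact h2 i j
  rw [← Nat.card_congr (Setoid.quotientKerEquivOfSurjective _ hs), hk,
    Nat.card_congr (Setoid.quotientKerEquivRange _), Nat.card_coe_set_eq, ncard_range_cornerLabel]

namespace HasCornerType

variable {V : Type*} {b : Fin 3 → V} {H : SimpleGraph V} {t : Fin 5}

theorem card_connectedComponent (h : HasCornerType b H t) :
    Nat.card H.ConnectedComponent = numClasses t :=
  card_connectedComponent_of_corners h.exists_reachable h.reachable_iff

theorem card_edgeSet [Finite V] (h : HasCornerType b H t) :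
    H.edgeSet.ncard + numClasses t = Nat.card V := by
  rw [← h.card_connectedComponent, ← H.isAcyclic_iff_card]
  exact h.isAcyclic

theorem unique {s : Fin 5} (hs : HasCornerType b H s) (ht : HasCornerType b H t) : s = t :=
  cornerLabel_unique fun i j => (hs.reachable_iff i j).symm.trans (ht.reachable_iff i j)

end HasCornerType

theorem exists_hasCornerType {V : Type*} {b : Fin 3 → V} {H : SimpleGraph V} (h : H.IsAcyclic)
    (h1 : ∀ v, ∃ i, H.Reachable v (b i)) : ∃ t, HasCornerType b H t := by
  obtain ⟨t, ht⟩ := exists_cornerLabel (r := fun i j => H.Reachable (b i) (b j))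
    ⟨fun _ => .refl _, fun h => h.symm, fun h h' => h.trans h'⟩
  exact ⟨t, h, h1, ht⟩

/-- The number of spanning forests of `G` of corner type `t`. -/
noncomputable def numCornerForests {V : Type*} (b : Fin 3 → V) (G : SimpleGraph V) (t : Fin 5) :
    ℕ :=
  {H | H ≤ G ∧ HasCornerType b H t}.ncard

end CornerType

/-! ### Gluing three copies at their corners -/

section Glue

variable {V W : Type*}

/-- Three copies of `V` with corners `b` are glued to `W` by the embeddings `f`: copy `i` and copy
`j` have just one point in common, the corner `j` of copy `i`, which is the corner `i` of
copy `j`. -/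
structure IsCornerGluing (f : Fin 3 → V ↪ W) (b : Fin 3 → V) : Prop where
  injective : Function.Injective b
  comm : ∀ i j, f i (b j) = f j (b i)
  eq_corner : ∀ {i j x y}, i ≠ j → f i x = f j y → x = b j ∧ y = b i
  cover : ∀ v, ∃ i x, f i x = v

/-- The union of one graph on each of the three copies. -/
def glueGraph (f : Fin 3 → V ↪ W) (h : Fin 3 → SimpleGraph V) : SimpleGraph W :=
  ⨆ i, (h i).map (f i)

theorem glueGraph_adj {f : Fin 3 → V ↪ W} {h : Fin 3 → SimpleGraph V} {v w : W} :
    (glueGraph f h).Adj v w ↔ ∃ i x y, (h i).Adj x y ∧ f i x = v ∧ f i y = w := by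
  simp only [glueGraph, SimpleGraph.iSup_adj, SimpleGraph.map_adj]

theorem glueGraph_mono {f : Fin 3 → V ↪ W} {h h' : Fin 3 → SimpleGraph V} (H : ∀ i, h i ≤ h' i) :
    glueGraph f h ≤ glueGraph f h' :=
  iSup_mono fun i => SimpleGraph.map_monotone _ (H i)

namespace IsCornerGluing

variable {f : Fin 3 → V ↪ W} {b : Fin 3 → V}

/-- Two copies share a single vertex, hence no edge, so each piece is recovered from the glued
graph. -/
theorem glueGraph_adj_apply (hf : IsCornerGluing f b) {h : Fin 3 → SimpleGraph V} {i : Fin 3}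
    {x y : V} : (glueGraph f h).Adj (f i x) (f i y) ↔ (h i).Adj x y := by
  rw [glueGraph_adj]
  constructor
  · rintro ⟨j, x', y', hadj, hx, hy⟩
    rcases eq_or_ne j i with rfl | hij
    · rwa [← (f j).injective hx, ← (f j).injective hy]
    · exact absurd ((hf.eq_corner hij hx).1.trans (hf.eq_corner hij hy).1.symm) hadj.ne
  · exact fun hadj => ⟨i, x, y, hadj, rfl, rfl⟩

theorem comap_glueGraph (hf : IsCornerGluing f b) (h : Fin 3 → SimpleGraph V) (i : Fin 3) :
    (glueGraph f h).comap (f i) = h i := by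
  ext x y
  exact hf.glueGraph_adj_apply

theorem glueGraph_comap {g : Fin 3 → SimpleGraph V} {H : SimpleGraph W} (hH : H ≤ glueGraph f g) :
    glueGraph f (fun i => H.comap (f i)) = H := by
  ext v w
  rw [glueGraph_adj]
  constructor
  · rintro ⟨i, x, y, hadj, rfl, rfl⟩
    exact hadj
  · intro hadj
    obtain ⟨i, x, y, -, rfl, rfl⟩ := glueGraph_adj.1 (hH hadj)
    exact ⟨i, x, y, hadj, rfl, rfl⟩

theorem edgeSet_ncard_glueGraph [Finite V] (hf : IsCornerGluing f b) (h : Fin 3 → SimpleGraph V) :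
    (glueGraph f h).edgeSet.ncard = ∑ i, (h i).edgeSet.ncard := by
  let φ : (Σ i, (h i).edgeSet) → (glueGraph f h).edgeSet := fun e =>
    ⟨e.2.1.map (f e.1), by
      obtain ⟨i, e, he⟩ := e
      induction e using Sym2.ind with | _ x y
      exact hf.glueGraph_adj_apply.2 he⟩
  have hφ : Function.Bijective φ := by
    constructor
    · rintro ⟨i, e, he⟩ ⟨j, e', he'⟩ hee
      replace hee : e.map (f i) = e'.map (f j) := congrArg Subtype.val hee
      rcases eq_or_ne i j with rfl | hij
      · obtain rfl := Sym2.map.injective (f i).injective hee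
        rfl
      · induction e using Sym2.ind with | _ x y
        induction e' using Sym2.ind with | _ x' y'
        exfalso
        refine SimpleGraph.Adj.ne he ?_
        simp only [Sym2.map_mk, Sym2.eq_iff] at hee
        rcases hee with ⟨h1, h2⟩ | ⟨h1, h2⟩ <;>
          exact (hf.eq_corner hij h1).1.trans (hf.eq_corner hij h2).1.symm
    · rintro ⟨e, he⟩
      induction e using Sym2.ind with | _ v w
      obtain ⟨i, x, y, hadj, rfl, rfl⟩ := glueGraph_adj.1 he
      exact ⟨⟨i, s(x, y), hadj⟩, rfl⟩
  rw [← Nat.card_coe_set_eq, ← Nat.card_congr (Equiv.ofBijective φ hφ), Nat.card_sigma]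
  simp [Nat.card_coe_set_eq]

/-- Inclusion–exclusion: the second copy meets the first in one point, and the third meets their
union in two distinct points. -/
theorem card_add_three [Finite V] (hf : IsCornerGluing f b) :
    Nat.card W + 3 = 3 * Nat.card V := by
  have hr : ∀ i, (Set.range (f i)).ncard = Nat.card V := fun i => by
    rw [← Set.image_univ, Set.ncard_image_of_injective _ (f i).injective, Set.ncard_univ]
  have hfin : ∀ i, (Set.range (f i)).Finite := fun i => Set.finite_range _
  have hW : (Set.range (f 0) ∪ Set.range (f 1)) ∪ Set.range (f 2) = Set.univ := by
    refine Set.eq_univ_of_forall fun v => ?_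
    obtain ⟨i, x, rfl⟩ := hf.cover v
    fin_cases i
    exacts [.inl (.inl ⟨x, rfl⟩), .inl (.inr ⟨x, rfl⟩), .inr ⟨x, rfl⟩]
  have h01 : Set.range (f 0) ∩ Set.range (f 1) = {f 0 (b 1)} := by
    ext v
    constructor
    · rintro ⟨⟨x, rfl⟩, ⟨y, hy⟩⟩
      rw [(hf.eq_corner (by decide) hy.symm).1]
      rfl
    · rintro rfl
      exact ⟨⟨_, rfl⟩, ⟨_, hf.comm 1 0⟩⟩
  have h2 : (Set.range (f 0) ∪ Set.range (f 1)) ∩ Set.range (f 2) = {f 2 (b 0), f 2 (b 1)} := by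
    ext v
    constructor
    · rintro ⟨⟨x, rfl⟩ | ⟨x, rfl⟩, ⟨y, hy⟩⟩
      · rw [(hf.eq_corner (by decide) hy.symm).1, hf.comm 0 2]
        exact .inl rfl
      · rw [(hf.eq_corner (by decide) hy.symm).1, hf.comm 1 2]
        exact .inr rfl
    · rintro (rfl | rfl)
      exacts [⟨.inl ⟨_, hf.comm 0 2⟩, ⟨_, rfl⟩⟩, ⟨.inr ⟨_, hf.comm 1 2⟩, ⟨_, rfl⟩⟩]
  have hne : f 2 (b 0) ≠ f 2 (b 1) := fun e =>
    absurd (hf.injective ((f 2).injective e)) (by decide)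
  have e1 := Set.ncard_union_add_ncard_inter (Set.range (f 0)) (Set.range (f 1)) (hfin 0) (hfin 1)
  have e2 := Set.ncard_union_add_ncard_inter _ _ ((hfin 0).union (hfin 1)) (hfin 2)
  rw [hW, h2, Set.ncard_univ, Set.ncard_pair hne, hr] at e2
  rw [h01, Set.ncard_singleton, hr, hr] at e1
  omega

end IsCornerGluing

end Glue

/-! ### Connectivity between the corners of the copies -/

section CornerRel

/-- The generators of the relation which corner types `t i` of three copies induce on the corners
of the copies: corner `(i, j)` is the corner `j` of copy `i`. -/
def cornerStep (t : Fin 3 → Fin 5) (p q : Fin 3 × Fin 3) : Prop :=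
  (p.1 = q.1 ∧ cornerLabel (t p.1) p.2 = cornerLabel (t p.1) q.2) ∨ (p.2 = q.1 ∧ q.2 = p.1)

/-- The equivalence relation which corner types of three copies induce on the corners of the
copies. -/
def cornerRel (t : Fin 3 → Fin 5) : Fin 3 × Fin 3 → Fin 3 × Fin 3 → Prop :=
  Relation.EqvGen (cornerStep t)

/-- Gluing forests of corner types `t i` yields a forest of corner type `r`. -/
structure GluesTo (t : Fin 3 → Fin 5) (r : Fin 5) : Prop where
  card : ∑ i, numClasses (t i) = numClasses r + 3
  exists_rel : ∀ p, ∃ i, cornerRel t p (i, i)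
  rel_iff : ∀ i j, cornerRel t (i, i) (j, j) ↔ cornerLabel r i = cornerLabel r j

end CornerRel

/-! ### Corner types under gluing -/

namespace IsCornerGluing

variable {V W : Type*} {f : Fin 3 → V ↪ W} {b : Fin 3 → V} {h : Fin 3 → SimpleGraph V}
  {t : Fin 3 → Fin 5}

theorem reachable_glueGraph {i : Fin 3} {x y : V} (hxy : (h i).Reachable x y) :
    (glueGraph f h).Reachable (f i x) (f i y) := by
  obtain ⟨p⟩ := hxy
  induction p with
  | nil => exact .refl _
  | cons hadj _ ih =>
    exact (SimpleGraph.Adj.reachable (glueGraph_adj.2 ⟨i, _, _, hadj, rfl, rfl⟩)).trans ih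

/-- Corners `p` and `q` are related if they can be reached inside a copy from one and the same
vertex. -/
theorem cornerRel_of_apply_eq (hf : IsCornerGluing f b) (ht : ∀ i, HasCornerType b (h i) (t i))
    {i k j l : Fin 3} {x y : V} (hxy : f i x = f k y) (hx : (h i).Reachable x (b j))
    (hy : (h k).Reachable y (b l)) : cornerRel t (i, j) (k, l) := by
  rcases eq_or_ne i k with rfl | hik
  · obtain rfl := (f i).injective hxy
    exact .rel _ _ (.inl ⟨rfl, ((ht i).reachable_iff j l).1 (hx.symm.trans hy)⟩)
  · obtain ⟨rfl, rfl⟩ := hf.eq_corner hik hxy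
    have h1 : cornerRel t (i, j) (i, k) :=
      .rel _ _ (.inl ⟨rfl, ((ht i).reachable_iff j k).1 hx.symm⟩)
    have h2 : cornerRel t (i, k) (k, i) := .rel _ _ (.inr ⟨rfl, rfl⟩)
    have h3 : cornerRel t (k, i) (k, l) :=
      .rel _ _ (.inl ⟨rfl, ((ht k).reachable_iff i l).1 hy⟩)
    exact (h1.trans _ _ _ h2).trans _ _ _ h3

/-- Each edge of a walk lies in one copy, where its endpoints reach a common corner; consecutive
such corners are related by `cornerRel_of_apply_eq`. -/
theorem cornerRel_of_reachable (hf : IsCornerGluing f b) (ht : ∀ i, HasCornerType b (h i) (t i))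
    {v w : W} (hvw : (glueGraph f h).Reachable v w) {i k j l : Fin 3} {x y : V} (hxv : f i x = v)
    (hyw : f k y = w) (hx : (h i).Reachable x (b j)) (hy : (h k).Reachable y (b l)) :
    cornerRel t (i, j) (k, l) := by
  obtain ⟨p⟩ := hvw
  induction p generalizing i x j with
  | nil => exact hf.cornerRel_of_apply_eq ht (hxv.trans hyw.symm) hx hy
  | cons hadj _ ih =>
    obtain ⟨m, x', y', hadj', hx', hy'⟩ := glueGraph_adj.1 hadj
    obtain ⟨n, hn⟩ := (ht m).exists_reachable x'
    exact (hf.cornerRel_of_apply_eq ht (hxv.trans hx'.symm) hx hn).trans _ _ _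
      (ih hy' hyw (hadj'.reachable.symm.trans hn))

theorem reachable_corner_iff (hf : IsCornerGluing f b) (ht : ∀ i, HasCornerType b (h i) (t i))
    (p q : Fin 3 × Fin 3) :
    (glueGraph f h).Reachable (f p.1 (b p.2)) (f q.1 (b q.2)) ↔ cornerRel t p q := by
  constructor
  · exact fun hr => hf.cornerRel_of_reachable ht hr rfl rfl (.refl _) (.refl _)
  · intro hr
    induction hr with
    | rel p q hpq =>
      obtain ⟨i, j⟩ := p
      obtain ⟨k, l⟩ := q
      rcases hpq with ⟨h1, h2⟩ | ⟨h1, h2⟩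
      · obtain rfl : i = k := h1
        exact reachable_glueGraph (((ht i).reachable_iff j l).2 h2)
      · obtain rfl : j = k := h1
        obtain rfl : l = i := h2
        exact hf.comm l j ▸ .refl _
    | refl p => exact .refl _
    | symm p q _ ih => exact ih.symm
    | trans p q r _ _ ih1 ih2 => exact ih1.trans ih2

/-- The two connectivity conditions translate through `cornerRel`. For acyclicity, the pieces have
`3|V| - ∑ numClasses (t i)` edges in total and `|W| = 3|V| - 3`, so the forest count for `numClasses
r` components is exactly the condition `GluesTo.card`. -/
theorem hasCornerType_glueGraph_iff [Finite V] (hf : IsCornerGluing f b)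
    (ht : ∀ i, HasCornerType b (h i) (t i)) (r : Fin 5) :
    HasCornerType (fun i => f i (b i)) (glueGraph f h) r ↔ GluesTo t r := by
  have : Finite W := Finite.of_surjective (fun p : Fin 3 × V => f p.1 p.2) fun v => by
    obtain ⟨i, x, hx⟩ := hf.cover v
    exact ⟨(i, x), hx⟩
  have h1 : (∀ v, ∃ i, (glueGraph f h).Reachable v (f i (b i))) ↔
      ∀ p, ∃ i, cornerRel t p (i, i) := by
    constructor
    · intro H p
      obtain ⟨i, hi⟩ := H (f p.1 (b p.2))
      exact ⟨i, (hf.reachable_corner_iff ht p (i, i)).1 hi⟩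
    · intro H v
      obtain ⟨i, x, rfl⟩ := hf.cover v
      obtain ⟨j, hj⟩ := (ht i).exists_reachable x
      obtain ⟨k, hk⟩ := H (i, j)
      exact ⟨k, (reachable_glueGraph hj).trans ((hf.reachable_corner_iff ht (i, j) (k, k)).2 hk)⟩
  have h2 : ∀ i j, (glueGraph f h).Reachable (f i (b i)) (f j (b j)) ↔
      cornerRel t (i, i) (j, j) := fun i j => hf.reachable_corner_iff ht (i, i) (j, j)
  have hE := hf.edgeSet_ncard_glueGraph h
  have hV := hf.card_add_three
  have hsum : ∑ i, ((h i).edgeSet.ncard + numClasses (t i)) = 3 * Nat.card V := by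
    simp [fun i => (ht i).card_edgeSet]
  rw [Finset.sum_add_distrib] at hsum
  constructor
  · intro H
    have := H.card_edgeSet
    exact ⟨by omega, h1.1 H.exists_reachable, fun i j => (h2 i j).symm.trans (H.reachable_iff i j)⟩
  · intro H
    have e1 := h1.2 H.exists_rel
    have e2 := fun i j => (h2 i j).trans (H.rel_iff i j)
    refine ⟨?_, e1, e2⟩
    rw [SimpleGraph.isAcyclic_iff_card, card_connectedComponent_of_corners (t := r) e1 e2]
    have := H.card
    omega

/-- Copies touch only at corners, so a component of a piece without corners could not be left inside
the glued graph and would contain no outmost vertex. -/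
theorem exists_reachable_of_glueGraph (hf : IsCornerGluing f b)
    (H : ∀ v, ∃ i, (glueGraph f h).Reachable v (f i (b i))) (i : Fin 3) (x : V) :
    ∃ j, (h i).Reachable x (b j) := by
  by_contra! hx
  have key : ∀ {v w : W}, (glueGraph f h).Reachable v w → ∀ y, (h i).Reachable x y → f i y = v →
      ∃ z, (h i).Reachable x z ∧ f i z = w := by
    rintro v w ⟨p⟩
    induction p with
    | nil => exact fun y hy e => ⟨y, hy, e⟩
    | cons hadj _ ih =>
      intro y hy e
      obtain ⟨k, a, c, hac, ha, hc⟩ := glueGraph_adj.1 hadj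
      rcases eq_or_ne i k with rfl | hik
      · obtain rfl := (f i).injective (e.trans ha.symm)
        exact ih c (hy.trans hac.reachable) hc
      · obtain ⟨rfl, -⟩ := hf.eq_corner hik (e.trans ha.symm)
        exact absurd hy (hx k)
  obtain ⟨m, hm⟩ := H (f i x)
  obtain ⟨z, hz, e⟩ := key hm x (.refl _) rfl
  rcases eq_or_ne i m with rfl | him
  · obtain rfl := (f i).injective e
    exact hx i hz
  · obtain ⟨rfl, -⟩ := hf.eq_corner him e
    exact hx m hz

theorem exists_hasCornerType_of_glueGraph (hf : IsCornerGluing f b) {r : Fin 5}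
    (H : HasCornerType (fun i => f i (b i)) (glueGraph f h) r) (i : Fin 3) :
    ∃ s, HasCornerType b (h i) s := by
  refine exists_hasCornerType ?_ (hf.exists_reachable_of_glueGraph H.exists_reachable i)
  rw [← hf.comap_glueGraph h i]
  exact H.isAcyclic.of_comap (f i)

open Classical in
/-- The gluing formula: forests of the glued graph are counted by triples of forests of the
pieces. -/
theorem numCornerForests_glueGraph [Finite V] (hf : IsCornerGluing f b) (G : SimpleGraph V)
    (r : Fin 5) :
    numCornerForests (fun i => f i (b i)) (glueGraph f fun _ => G) r =
      ∑ t : Fin 3 → Fin 5 with GluesTo t r, ∏ i, numCornerForests b G (t i) := by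
  have := Fintype.ofFinite (SimpleGraph V)
  let S : Fin 5 → Finset (SimpleGraph V) := fun s => {K | K ≤ G ∧ HasCornerType b K s}
  have hS : ∀ s, numCornerForests b G s = (S s).card := fun s => by
    rw [numCornerForests, ← Set.ncard_coe_finset]
    simp [S]
  have hmem : ∀ {s K}, K ∈ S s ↔ K ≤ G ∧ HasCornerType b K s := by simp [S]
  -- Restriction to the copies inverts gluing, so forests correspond to triples of forests, sorted
  -- by their types. Uniqueness of types makes the union disjoint.
  have himg : {H | H ≤ (glueGraph f fun _ => G) ∧ HasCornerType (fun i => f i (b i)) H r} =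
      glueGraph f '' ↑((Finset.univ.filter fun t : Fin 3 → Fin 5 => GluesTo t r).biUnion
        fun t => Fintype.piFinset fun i => S (t i)) := by
    ext H
    simp only [Set.mem_ofPred_eq, Set.mem_image, Finset.mem_coe, Finset.mem_biUnion,
      Finset.mem_filter, Finset.mem_univ, true_and, Fintype.mem_piFinset, hmem]
    constructor
    · rintro ⟨hle, hH⟩
      have e := glueGraph_comap hle
      have hH' := hH
      rw [← e] at hH'
      choose t ht using hf.exists_hasCornerType_of_glueGraph hH'
      refine ⟨_, ⟨t, (hf.hasCornerType_glueGraph_iff ht r).1 hH', fun i => ⟨?_, ht i⟩⟩, e⟩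
      rw [← hf.comap_glueGraph (fun _ => G) i]
      exact SimpleGraph.comap_monotone _ hle
    · rintro ⟨h, ⟨t, ht, hh⟩, rfl⟩
      exact ⟨glueGraph_mono fun i => (hh i).1,
        (hf.hasCornerType_glueGraph_iff (fun i => (hh i).2) r).2 ht⟩
  have hinj : Function.Injective (glueGraph f) := fun h h' e => funext fun i => by
    rw [← hf.comap_glueGraph h i, e, hf.comap_glueGraph]
  rw [numCornerForests, himg, Set.ncard_image_of_injective _ hinj, Set.ncard_coe_finset,
    Finset.card_biUnion]
  · simp [hS, Fintype.card_piFinset]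
  · intro t _ t' _ hne
    rw [Function.onFun, Finset.disjoint_left]
    intro h hh hh'
    rw [Fintype.mem_piFinset] at hh hh'
    exact hne (funext fun i => (hmem.1 (hh i)).2.unique (hmem.1 (hh' i)).2)

end IsCornerGluing

/-! ### Counting the triples of types by computation -/

section Counting

/-- A two-colouring of the corners of the three copies. The corners `(i, j)` and `(j, i)` are the
same point and share a colour. -/
def cornerColouring (x y z u v w : Bool) : Fin 3 → Fin 3 → Bool :=
  ![![x, u, v], ![u, y, w], ![v, w, z]]

/-- The colouring `x, y, z` of the corners is constant on the classes of the partition `t`. -/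
def respectsLabel (t : Fin 5) (x y z : Bool) : Bool :=
  (![x == y && y == z, y == z, x == z, x == y, true] : Fin 5 → Bool) t

theorem respectsLabel_iff {t : Fin 5} {x y z : Bool} : respectsLabel t x y z = true ↔
    ∀ i j, cornerLabel t i = cornerLabel t j →
      (![x, y, z] : Fin 3 → Bool) i = (![x, y, z] : Fin 3 → Bool) j := by
  revert t x y z
  decide

/-- Two points are related by the generated equivalence iff no two-colouring constant along the
generators separates them, which makes the relation decidable. The hypotheses are interleaved with
the quantifiers so that a colouring is discarded as soon as one copy violates it. -/
theorem cornerRel_iff_colouring {t : Fin 3 → Fin 5} {p q : Fin 3 × Fin 3} :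
    cornerRel t p q ↔ ∀ x u v, respectsLabel (t 0) x u v = true → ∀ y w,
      respectsLabel (t 1) u y w = true → ∀ z, respectsLabel (t 2) v w z = true →
        cornerColouring x y z u v w p.1 p.2 = cornerColouring x y z u v w q.1 q.2 := by
  constructor
  · intro h x u v h0 y w h1 z h2
    rw [respectsLabel_iff] at h0 h1 h2
    induction h with
    | rel p q hpq =>
      obtain ⟨i, j⟩ := p
      obtain ⟨k, l⟩ := q
      rcases hpq with ⟨e1, e2⟩ | ⟨e1, e2⟩
      · obtain rfl : i = k := e1
        fin_cases i
        exacts [h0 j l e2, h1 j l e2, h2 j l e2]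
      · obtain rfl : j = k := e1
        obtain rfl : l = i := e2
        fin_cases l <;> fin_cases j <;> rfl
    | refl p => rfl
    | symm p q _ ih => exact ih.symm
    | trans p q r _ _ ih1 ih2 => exact ih1.trans ih2
  · intro h
    classical
    -- The test colouring is the indicator of the class of `p`.
    have hsymm : ∀ i j, decide (cornerRel t p (i, j)) = decide (cornerRel t p (j, i)) := fun i j =>
      decide_eq_decide.2 ⟨fun H => H.trans _ _ _ (.rel _ _ (.inr ⟨rfl, rfl⟩)),
        fun H => H.trans _ _ _ (.rel _ _ (.inr ⟨rfl, rfl⟩))⟩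
    have hlab : ∀ i j k, cornerLabel (t i) j = cornerLabel (t i) k →
        decide (cornerRel t p (i, j)) = decide (cornerRel t p (i, k)) := fun i j k e =>
      decide_eq_decide.2 ⟨fun H => H.trans _ _ _ (.rel _ _ (.inl ⟨rfl, e⟩)),
        fun H => H.trans _ _ _ (.rel _ _ (.inl ⟨rfl, e.symm⟩))⟩
    have hc : ∀ q : Fin 3 × Fin 3, cornerColouring (decide (cornerRel t p (0, 0)))
        (decide (cornerRel t p (1, 1))) (decide (cornerRel t p (2, 2)))
        (decide (cornerRel t p (0, 1))) (decide (cornerRel t p (0, 2)))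
        (decide (cornerRel t p (1, 2))) q.1 q.2 = decide (cornerRel t p q) := by
      rintro ⟨i, j⟩
      fin_cases i <;> fin_cases j
      exacts [rfl, rfl, rfl, hsymm 0 1, rfl, rfl, hsymm 0 2, hsymm 1 2, rfl]
    have := h (decide (cornerRel t p (0, 0))) (decide (cornerRel t p (0, 1)))
      (decide (cornerRel t p (0, 2))) (respectsLabel_iff.2 fun i j e => by
        exact (hc (0, i)).trans ((hlab 0 i j e).trans (hc (0, j)).symm)) (decide (cornerRel t p (1, 1)))
      (decide (cornerRel t p (1, 2))) (respectsLabel_iff.2 fun i j e => by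
        exact (hc (1, i)).trans ((hlab 1 i j e).trans (hc (1, j)).symm)) (decide (cornerRel t p (2, 2)))
      (respectsLabel_iff.2 fun i j e => by
        exact (hc (2, i)).trans ((hlab 2 i j e).trans (hc (2, j)).symm))
    rw [hc, hc, decide_eq_decide] at this
    exact this.1 (.refl _)

instance (t : Fin 3 → Fin 5) (p q : Fin 3 × Fin 3) : Decidable (cornerRel t p q) :=
  decidable_of_iff _ cornerRel_iff_colouring.symm

instance (t : Fin 3 → Fin 5) (r : Fin 5) : Decidable (GluesTo t r) :=
  decidable_of_iff (∑ i, numClasses (t i) = numClasses r + 3 ∧ (∀ p, ∃ i, cornerRel t p (i, i)) ∧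
      ∀ i j, cornerRel t (i, i) (j, j) ↔ cornerLabel r i = cornerLabel r j)
    ⟨fun h => ⟨h.1, h.2.1, h.2.2⟩, fun h => ⟨h.card, h.exists_rel, h.rel_iff⟩⟩

/-- Three trees would close a cycle through the shared points. So one copy has two classes, and they
must separate its two shared corners: three copies with two partitions each. -/
theorem card_gluesTo_zero :
    (Finset.univ.filter fun t : Fin 3 → Fin 5 => GluesTo t 0).card = 6 := by
  decide +kernel

/-- The class numbers add up to five, as 1 + 1 + 3 or 1 + 2 + 2. In the first case the copy with
three classes must be the one at the isolated corner. -/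
theorem card_gluesTo_two : ∀ r, numClasses r = 2 →
    ((Finset.univ.filter fun t : Fin 3 → Fin 5 => GluesTo t r).filter
      fun t => ∃ i, numClasses (t i) = 3).card = 1 ∧
    ((Finset.univ.filter fun t : Fin 3 → Fin 5 => GluesTo t r).filter
      fun t => ¬ ∃ i, numClasses (t i) = 3).card = 7 := by
  decide +kernel

/-- The class numbers add up to six, as 1 + 2 + 3 or 2 + 2 + 2. -/
theorem card_gluesTo_four :
    ((Finset.univ.filter fun t : Fin 3 → Fin 5 => GluesTo t 4).filter
      fun t => ∃ i, numClasses (t i) = 3).card = 12 ∧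
    ((Finset.univ.filter fun t : Fin 3 → Fin 5 => GluesTo t 4).filter
      fun t => ¬ ∃ i, numClasses (t i) = 3).card = 14 := by
  decide +kernel

end Counting

/-! ### The recursions for the forest numbers -/

section Recursion

theorem numClasses_pos (t : Fin 5) : 0 < numClasses t := by
  revert t
  decide

theorem numClasses_le (t : Fin 5) : numClasses t ≤ 3 := by
  revert t
  decide

/-- The sum over the triples of corner types which glue to `r`, split according to whether one of
the types has three classes. -/
theorem sum_gluesTo (w : ℕ → ℕ) (r : Fin 5) (A B : ℕ)
    (hA : ∀ t, GluesTo t r → (∃ i, numClasses (t i) = 3) → ∏ i, w (numClasses (t i)) = A)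
    (hB : ∀ t, GluesTo t r → (¬ ∃ i, numClasses (t i) = 3) → ∏ i, w (numClasses (t i)) = B) :
    ∑ t : Fin 3 → Fin 5 with GluesTo t r, ∏ i, w (numClasses (t i)) =
      ((Finset.univ.filter fun t : Fin 3 → Fin 5 => GluesTo t r).filter
        fun t => ∃ i, numClasses (t i) = 3).card * A +
      ((Finset.univ.filter fun t : Fin 3 → Fin 5 => GluesTo t r).filter
        fun t => ¬ ∃ i, numClasses (t i) = 3).card * B := by
  rw [← Finset.sum_filter_add_sum_filter_not _ fun t => ∃ i, numClasses (t i) = 3]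
  congr 1
  · refine (Finset.sum_eq_card_nsmul fun t ht => ?_).trans (smul_eq_mul _ _)
    simp only [Finset.mem_filter, Finset.mem_univ, true_and] at ht
    exact hA t ht.1 ht.2
  · refine (Finset.sum_eq_card_nsmul fun t ht => ?_).trans (smul_eq_mul _ _)
    simp only [Finset.mem_filter, Finset.mem_univ, true_and] at ht
    exact hB t ht.1 ht.2

/-- Replaces the types by three class numbers between 1 and 3, so that a small case check on numbers
suffices. -/
theorem prod_classes_eq (w : ℕ → ℕ) (t : Fin 3 → Fin 5) {A : ℕ}
    (h : ∀ a b c : ℕ, 0 < a → 0 < b → 0 < c → a ≤ 3 → b ≤ 3 → c ≤ 3 →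
      a + b + c = ∑ i, numClasses (t i) →
      ((∃ i, numClasses (t i) = 3) ↔ a = 3 ∨ b = 3 ∨ c = 3) → w a * w b * w c = A) :
    ∏ i, w (numClasses (t i)) = A := by
  rw [Fin.prod_univ_three]
  refine h _ _ _ (numClasses_pos _) (numClasses_pos _) (numClasses_pos _) (numClasses_le _)
    (numClasses_le _) (numClasses_le _) (Fin.sum_univ_three fun i => numClasses (t i)).symm ?_
  simp [Fin.exists_fin_succ]

theorem sum_gluesTo_zero (w : ℕ → ℕ) :
    ∑ t : Fin 3 → Fin 5 with GluesTo t 0, ∏ i, w (numClasses (t i)) = 6 * (w 1 ^ 2 * w 2) := by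
  refine (Finset.sum_eq_card_nsmul fun t ht => ?_).trans
    ((smul_eq_mul _ _).trans (by rw [card_gluesTo_zero]))
  simp only [Finset.mem_filter, Finset.mem_univ, true_and] at ht
  refine prod_classes_eq w t fun a b c ha hb hc ha' hb' hc' hs _ => ?_
  rw [ht.card, show numClasses 0 = 1 from rfl] at hs
  interval_cases a <;> interval_cases b <;> interval_cases c <;> first | (exfalso; omega) | ring1

theorem sum_gluesTo_two (w : ℕ → ℕ) {r : Fin 5} (hr : numClasses r = 2) :
    ∑ t : Fin 3 → Fin 5 with GluesTo t r, ∏ i, w (numClasses (t i)) =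
      w 1 ^ 2 * w 3 + 7 * (w 1 * w 2 ^ 2) := by
  rw [sum_gluesTo w r (w 1 ^ 2 * w 3) (w 1 * w 2 ^ 2), (card_gluesTo_two r hr).1,
    (card_gluesTo_two r hr).2, one_mul]
  · intro t ht h3
    refine prod_classes_eq w t fun a b c ha hb hc ha' hb' hc' hs h => ?_
    rw [ht.card, hr] at hs
    replace h := h.1 h3
    interval_cases a <;> interval_cases b <;> interval_cases c <;> first | (exfalso; omega) | ring1
  · intro t ht h3
    refine prod_classes_eq w t fun a b c ha hb hc ha' hb' hc' hs h => ?_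
    rw [ht.card, hr] at hs
    replace h : ¬ (a = 3 ∨ b = 3 ∨ c = 3) := fun h' => h3 (h.2 h')
    interval_cases a <;> interval_cases b <;> interval_cases c <;> first | (exfalso; omega) | ring1

theorem sum_gluesTo_four (w : ℕ → ℕ) :
    ∑ t : Fin 3 → Fin 5 with GluesTo t 4, ∏ i, w (numClasses (t i)) =
      12 * (w 1 * w 2 * w 3) + 14 * w 2 ^ 3 := by
  rw [sum_gluesTo w 4 (w 1 * w 2 * w 3) (w 2 ^ 3), card_gluesTo_four.1, card_gluesTo_four.2]
  · intro t ht h3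
    refine prod_classes_eq w t fun a b c ha hb hc ha' hb' hc' hs h => ?_
    rw [ht.card, show numClasses 4 = 3 from rfl] at hs
    replace h := h.1 h3
    interval_cases a <;> interval_cases b <;> interval_cases c <;> first | (exfalso; omega) | ring1
  · intro t ht h3
    refine prod_classes_eq w t fun a b c ha hb hc ha' hb' hc' hs h => ?_
    rw [ht.card, show numClasses 4 = 3 from rfl] at hs
    replace h : ¬ (a = 3 ∨ b = 3 ∨ c = 3) := fun h' => h3 (h.2 h')
    interval_cases a <;> interval_cases b <;> interval_cases c <;> first | (exfalso; omega) | ring1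

/-- The hypothesis `hw` says that the three two-class types have equally many forests; it comes from
the induction over the levels. -/
theorem IsCornerGluing.numCornerForests_eq_sum {V W : Type*} [Finite V] {f : Fin 3 → V ↪ W}
    {b : Fin 3 → V} (hf : IsCornerGluing f b) (G : SimpleGraph V) {w : ℕ → ℕ}
    (hw : ∀ t, numCornerForests b G t = w (numClasses t)) (r : Fin 5) :
    numCornerForests (fun i => f i (b i)) (glueGraph f fun _ => G) r =
      ∑ t : Fin 3 → Fin 5 with GluesTo t r, ∏ i, w (numClasses (t i)) := by
  rw [hf.numCornerForests_glueGraph G r]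
  simp only [hw]
  congr!

end Recursion

/-! ### The base case: the triangle -/

section Triangle

/-- The graph on three vertices with the given edges `01`, `02`, `12`. -/
def triangleSubgraph (s : Bool × Bool × Bool) : SimpleGraph (Fin 3) where
  Adj i j := (![![false, s.1, s.2.1], ![s.1, false, s.2.2], ![s.2.1, s.2.2, false]] :
    Fin 3 → Fin 3 → Bool) i j = true
  symm := ⟨by revert s; decide⟩
  loopless := ⟨by revert s; decide⟩

instance (s : Bool × Bool × Bool) : DecidableRel (triangleSubgraph s).Adj := fun i j =>
  inferInstanceAs (Decidable ((![![false, s.1, s.2.1], ![s.1, false, s.2.2],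
    ![s.2.1, s.2.2, false]] : Fin 3 → Fin 3 → Bool) i j = true))

theorem triangleSubgraph_injective : Function.Injective triangleSubgraph := by
  intro s s' h
  have h1 : ∀ i j, (triangleSubgraph s).Adj i j ↔ (triangleSubgraph s').Adj i j := by simp [h]
  clear h
  revert s s'
  decide

theorem triangleSubgraph_surjective : Function.Surjective triangleSubgraph := by
  classical
  intro H
  refine ⟨(decide (H.Adj 0 1), decide (H.Adj 0 2), decide (H.Adj 1 2)), ?_⟩
  ext i j
  fin_cases i <;> fin_cases j <;> simp [triangleSubgraph] <;>
    exact H.adj_comm _ _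

/-- On three vertices a path has at most two edges; this turns reachability into a finite check. -/
theorem triangleSubgraph_reachable_iff {s : Bool × Bool × Bool} {i j : Fin 3} :
    (triangleSubgraph s).Reachable i j ↔ i = j ∨ (triangleSubgraph s).Adj i j ∨
      ∃ k, (triangleSubgraph s).Adj i k ∧ (triangleSubgraph s).Adj k j := by
  constructor
  · rintro ⟨p⟩
    induction p with
    | nil => exact .inl rfl
    | @cons a c d hadj p ih =>
      clear p
      revert s a c d
      decide
  · rintro (rfl | h | ⟨k, h, h'⟩)
    exacts [.refl _, h.reachable, h.reachable.trans h'.reachable]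

/-- Every vertex is a corner, so only the partition and the edge count, equivalent to acyclicity,
remain to be checked. -/
theorem triangleSubgraph_hasCornerType_iff {s : Bool × Bool × Bool} {t : Fin 5} :
    HasCornerType id (triangleSubgraph s) t ↔
      (triangleSubgraph s).edgeFinset.card + numClasses t = 3 ∧
      ∀ i j, (i = j ∨ (triangleSubgraph s).Adj i j ∨
        ∃ k, (triangleSubgraph s).Adj i k ∧ (triangleSubgraph s).Adj k j) ↔
          cornerLabel t i = cornerLabel t j := by
  have hE : (triangleSubgraph s).edgeFinset.card = (triangleSubgraph s).edgeSet.ncard := by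
    rw [← Set.ncard_coe_finset, SimpleGraph.coe_edgeFinset]
  simp only [← triangleSubgraph_reachable_iff, hE]
  constructor
  · exact fun h => ⟨by simpa using h.card_edgeSet, h.reachable_iff⟩
  · rintro ⟨h1, h2⟩
    have h3 : ∀ v, ∃ i, (triangleSubgraph s).Reachable v (id i) := fun v => ⟨v, .refl _⟩
    refine ⟨?_, h3, h2⟩
    rw [SimpleGraph.isAcyclic_iff_card, card_connectedComponent_of_corners h3 h2, h1]
    simp

theorem numCornerForests_triangle (t : Fin 5) :
    numCornerForests id (⊤ : SimpleGraph (Fin 3)) t = if numClasses t = 1 then 3 else 1 := by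
  have h : {H : SimpleGraph (Fin 3) | H ≤ ⊤ ∧ HasCornerType id H t} = triangleSubgraph ''
      ↑(Finset.univ.filter fun s : Bool × Bool × Bool =>
        (triangleSubgraph s).edgeFinset.card + numClasses t = 3 ∧
        ∀ i j, (i = j ∨ (triangleSubgraph s).Adj i j ∨
          ∃ k, (triangleSubgraph s).Adj i k ∧ (triangleSubgraph s).Adj k j) ↔
            cornerLabel t i = cornerLabel t j) := by
    ext H
    obtain ⟨s, rfl⟩ := triangleSubgraph_surjective H
    simp [triangleSubgraph_injective.eq_iff, triangleSubgraph_hasCornerType_iff]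
  rw [numCornerForests, h, Set.ncard_image_of_injective _ triangleSubgraph_injective,
    Set.ncard_coe_finset]
  clear h
  revert t
  decide +kernel

theorem numCornerForests_of_bijective {V : Type*} {b : Fin 3 → V} (hb : Function.Bijective b)
    (t : Fin 5) :
    numCornerForests b (⊤ : SimpleGraph V) t = if numClasses t = 1 then 3 else 1 := by
  let e : Fin 3 ≃ V := Equiv.ofBijective b hb
  rw [← numCornerForests_triangle t, numCornerForests, numCornerForests,
    ← Set.ncard_image_of_injective _ (SimpleGraph.map_injective e.toEmbedding)]
  congr 1
  have key : ∀ H : SimpleGraph (Fin 3),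
      HasCornerType b (H.map e.toEmbedding) t ↔ HasCornerType id H t := by
    intro H
    let φ : H ≃g H.map e.toEmbedding := SimpleGraph.Iso.map e H
    have hr : ∀ i j, (H.map e.toEmbedding).Reachable (b i) (b j) ↔ H.Reachable i j :=
      fun i j => φ.reachable_iff
    constructor
    · exact fun h => ⟨φ.isAcyclic_iff.2 h.isAcyclic, fun i => ⟨i, .refl _⟩,
        fun i j => (hr i j).symm.trans (h.reachable_iff i j)⟩
    · refine fun h => ⟨φ.isAcyclic_iff.1 h.isAcyclic, fun v => ?_,
        fun i j => (hr i j).trans (h.reachable_iff i j)⟩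
      obtain ⟨i, rfl⟩ := hb.2 v
      exact ⟨i, .refl _⟩
  ext H
  constructor
  · intro hH
    have e1 : (H.comap e).map e.toEmbedding = H := by
      ext v w
      obtain ⟨i, rfl⟩ := e.surjective v
      obtain ⟨j, rfl⟩ := e.surjective w
      change ((H.comap e).map e.toEmbedding).Adj (e.toEmbedding i) (e.toEmbedding j) ↔ _
      rw [SimpleGraph.map_adj_apply]
      rfl
    exact ⟨H.comap e, ⟨le_top, (key _).1 (e1.symm ▸ hH.2)⟩, e1⟩
  · rintro ⟨H, hH, rfl⟩
    exact ⟨le_top, (key H).2 hH.2⟩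

end Triangle

/-! ### Spanning trees and spanning forests as corner types -/

section Interface

variable {V : Type*} {b : Fin 3 → V}

theorem cornerLabel_zero (i j : Fin 3) : cornerLabel 0 i = cornerLabel 0 j := by
  revert i j
  decide

theorem numSpanningTrees_eq_numCornerForests (G : SimpleGraph V) :
    numSpanningTrees G = numCornerForests b G 0 := by
  rw [numSpanningTrees, numCornerForests]
  congr 1
  ext H
  refine and_congr_right fun _ => ⟨fun h => ⟨h.isAcyclic, fun v => ⟨0, h.connected v _⟩,
    fun i j => iff_of_true (h.connected _ _) (cornerLabel_zero i j)⟩, fun h => ⟨?_, h.isAcyclic⟩⟩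
  have : Nonempty V := ⟨b 0⟩
  refine SimpleGraph.Connected.mk fun v w => ?_
  obtain ⟨i, hi⟩ := h.exists_reachable v
  obtain ⟨j, hj⟩ := h.exists_reachable w
  exact (hi.trans ((h.reachable_iff i j).2 (cornerLabel_zero i j))).trans hj.symm

/-- The corners already occupy `numClasses t` components, so with exactly that many components none
can miss the corners. -/
theorem isSpanningForest_and_reachable_iff [Finite V] {G H : SimpleGraph V} {t : Fin 5} :
    (IsSpanningForest G (numClasses t) H ∧
      ∀ i j, H.Reachable (b i) (b j) ↔ cornerLabel t i = cornerLabel t j) ↔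
    H ≤ G ∧ HasCornerType b H t := by
  have hE : ENat.card H.ConnectedComponent = numClasses t ↔
      Nat.card H.ConnectedComponent = numClasses t := by
    rw [ENat.card_eq_coe_natCard, Nat.cast_inj]
  rw [IsSpanningForest, hE]
  constructor
  · rintro ⟨⟨hle, hac, hcard⟩, hr⟩
    refine ⟨hle, hac, fun v => ?_, hr⟩
    by_contra! hv
    -- One component for each class, and the component of `v` as an extra one: too many.
    let c : Option (Set.range (cornerLabel t)) → H.ConnectedComponent := fun o =>
      o.elim (H.connectedComponentMk v) fun x => H.connectedComponentMk (b x.2.choose)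
    have hc : Function.Injective c := by
      rintro (_ | x) (_ | y) h
      · rfl
      · exact absurd (SimpleGraph.ConnectedComponent.exact h) (hv _)
      · exact absurd (SimpleGraph.ConnectedComponent.exact h).symm (hv _)
      · have := (hr _ _).1 (SimpleGraph.ConnectedComponent.exact h)
        rw [x.2.choose_spec, y.2.choose_spec] at this
        rw [Subtype.ext this]
    have := Nat.card_le_card_of_injective c hc
    rw [hcard, Finite.card_option, Nat.card_coe_set_eq, ncard_range_cornerLabel] at this
    omega
  · rintro ⟨hle, h⟩
    exact ⟨⟨hle, h.isAcyclic, h.card_connectedComponent⟩, h.reachable_iff⟩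

/-- Here `k.succ.castSucc` is the number `k + 1` in `Fin 5`, that is, the partition isolating corner
`k`. -/
theorem cornerLabel_eq_and_ne_iff {i j k : Fin 3} (hij : i ≠ j) (hik : i ≠ k) (hjk : j ≠ k)
    {t : Fin 5} : (cornerLabel t i = cornerLabel t j ∧ cornerLabel t i ≠ cornerLabel t k) ↔
      t = k.succ.castSucc := by
  revert i j k t
  decide

theorem numClasses_succ (k : Fin 3) : numClasses k.succ.castSucc = 2 := by
  revert k
  decide

theorem reachable_corners_two_iff {H : SimpleGraph V} {i j k : Fin 3} (hij : i ≠ j) (hik : i ≠ k)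
    (hjk : j ≠ k) : (H.Reachable (b i) (b j) ∧ ¬ H.Reachable (b i) (b k)) ↔
      ∀ x y, H.Reachable (b x) (b y) ↔
        cornerLabel k.succ.castSucc x = cornerLabel k.succ.castSucc y := by
  obtain ⟨t, ht⟩ := exists_cornerLabel (r := fun i j => H.Reachable (b i) (b j))
    ⟨fun _ => .refl _, fun h => h.symm, fun h h' => h.trans h'⟩
  simp only [ht]
  rw [← ne_eq, cornerLabel_eq_and_ne_iff hij hik hjk]
  exact ⟨fun h x y => h ▸ Iff.rfl, cornerLabel_unique⟩

theorem cornerLabel_four {x y : Fin 3} : cornerLabel 4 x = cornerLabel 4 y ↔ x = y := by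
  revert x y
  decide

theorem reachable_corners_three_iff {H : SimpleGraph V} :
    (∀ i j, i ≠ j → ¬ H.Reachable (b i) (b j)) ↔
      ∀ x y, H.Reachable (b x) (b y) ↔ cornerLabel 4 x = cornerLabel 4 y := by
  simp only [cornerLabel_four]
  refine ⟨fun h x y => ⟨fun hr => by_contra fun hne => h x y hne hr, ?_⟩,
    fun h i j hne hr => hne ((h i j).1 hr)⟩
  rintro rfl
  exact .refl _

end Interface

/-! ### The Sierpiński graph as a corner gluing -/

section Sierpinski

/-- Confines level `n` to a triangle. Two of its three translates have just one lattice point in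
common, which yields `eq_corner` below. -/
theorem fst_add_snd_le_of_mem {n : ℕ} {p : ℕ × ℕ} (hp : p ∈ sierpinskiVertices n) :
    p.1 + p.2 ≤ 2 ^ n := by
  induction n generalizing p with
  | zero =>
    simp only [sierpinskiVertices, Finset.mem_insert, Finset.mem_singleton] at hp
    rcases hp with rfl | rfl | rfl <;> simp
  | succ n ih =>
    simp only [sierpinskiVertices, Finset.mem_union, Finset.mem_map, latticeShift,
      addRightEmbedding_apply] at hp
    rw [pow_succ]
    rcases hp with (hp | ⟨q, hq, rfl⟩) | ⟨q, hq, rfl⟩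
    · have := ih hp; omega
    · have := ih hq; simp only [Prod.fst_add, Prod.snd_add]; omega
    · have := ih hq; simp only [Prod.fst_add, Prod.snd_add]; omega

/-- The translation vectors are the corner points themselves, the first being zero. Corner `j` of
copy `i` is therefore a sum symmetric in `i` and `j`, and the gluing condition `comm` is
commutativity of addition. -/
theorem mem_sierpinskiVertices_succ {n : ℕ} {p : ℕ × ℕ} :
    p ∈ sierpinskiVertices (n + 1) ↔
      ∃ i, ∃ q ∈ sierpinskiVertices n, q + sierpinskiCornerPoint n i = p := by
  simp only [sierpinskiVertices, Finset.mem_union, Finset.mem_map, latticeShift,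
    addRightEmbedding_apply, sierpinskiCornerPoint, Fin.exists_fin_succ]
  simp [or_assoc, -Prod.exists, Prod.mk_zero_zero]

theorem sierpinskiLattice_succ_adj {n : ℕ} {p q : ℕ × ℕ} :
    (sierpinskiLattice (n + 1)).Adj p q ↔ ∃ i x y, (sierpinskiLattice n).Adj x y ∧
      x + sierpinskiCornerPoint n i = p ∧ y + sierpinskiCornerPoint n i = q := by
  simp only [sierpinskiLattice, SimpleGraph.sup_adj, SimpleGraph.map_adj, latticeShift,
    addRightEmbedding_apply, sierpinskiCornerPoint, Fin.exists_fin_succ]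
  simp [or_assoc, -Prod.exists, Prod.mk_zero_zero]

theorem mem_of_sierpinskiLattice_adj {n : ℕ} {p q : ℕ × ℕ} (h : (sierpinskiLattice n).Adj p q) :
    p ∈ sierpinskiVertices n := by
  induction n generalizing p q with
  | zero =>
    simp only [sierpinskiLattice, SimpleGraph.fromEdgeSet_adj, Set.mem_insert_iff,
      Set.mem_singleton_iff, Sym2.eq_iff] at h
    simp only [sierpinskiVertices, Finset.mem_insert, Finset.mem_singleton]
    tauto
  | succ n ih =>
    obtain ⟨i, x, y, hadj, rfl, rfl⟩ := sierpinskiLattice_succ_adj.1 h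
    exact mem_sierpinskiVertices_succ.2 ⟨i, x, ih hadj, rfl⟩

/-- The three copies of `Γ_n` in `Γ_{n + 1}`. -/
def sierpinskiCopy (n : ℕ) (i : Fin 3) :
    {p : ℕ × ℕ // p ∈ sierpinskiVertices n} ↪ {p : ℕ × ℕ // p ∈ sierpinskiVertices (n + 1)} where
  toFun p := ⟨p.1 + sierpinskiCornerPoint n i, mem_sierpinskiVertices_succ.2 ⟨i, p.1, p.2, rfl⟩⟩
  inj' _ _ h := Subtype.ext (add_right_cancel (congrArg Subtype.val h))

theorem isCornerGluing_sierpinskiCopy (n : ℕ) :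
    IsCornerGluing (sierpinskiCopy n) (sierpinskiCorner n) where
  injective i j h := by
    have hpos : 0 < 2 ^ n := by positivity
    have h' : sierpinskiCornerPoint n i = sierpinskiCornerPoint n j := congrArg Subtype.val h
    clear h
    fin_cases i <;> fin_cases j <;> first | rfl | skip
    all_goals
      exfalso
      simp [sierpinskiCornerPoint] at h'
    all_goals omega
  comm i j := Subtype.ext (add_comm _ _)
  eq_corner {i j x y} hij h := by
    obtain ⟨⟨x1, x2⟩, hx⟩ := x
    obtain ⟨⟨y1, y2⟩, hy⟩ := y
    have hx' := fst_add_snd_le_of_mem hx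
    have hy' := fst_add_snd_le_of_mem hy
    have h' := congrArg Subtype.val h
    simp only [Subtype.ext_iff, sierpinskiCorner]
    simp only [sierpinskiCopy] at h' hx' hy'
    fin_cases i <;> fin_cases j <;> first | exact absurd rfl hij | skip
    all_goals
      simp [sierpinskiCornerPoint] at h' ⊢
      omega
  cover v := by
    obtain ⟨i, q, hq, h⟩ := mem_sierpinskiVertices_succ.1 v.2
    exact ⟨i, ⟨q, hq⟩, Subtype.ext h⟩

theorem sierpinskiCopy_corner (n : ℕ) :
    (fun i => sierpinskiCopy n i (sierpinskiCorner n i)) = sierpinskiCorner (n + 1) := by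
  funext i
  refine Subtype.ext ?_
  change sierpinskiCornerPoint n i + sierpinskiCornerPoint n i = sierpinskiCornerPoint (n + 1) i
  fin_cases i <;> simp [sierpinskiCornerPoint, pow_succ, mul_two]

theorem glueGraph_sierpinskiGraph (n : ℕ) :
    (glueGraph (sierpinskiCopy n) fun _ => sierpinskiGraph n) = sierpinskiGraph (n + 1) := by
  ext v w
  rw [glueGraph_adj]
  change _ ↔ (sierpinskiLattice (n + 1)).Adj v.1 w.1
  rw [sierpinskiLattice_succ_adj]
  constructor
  · rintro ⟨i, x, y, hadj, rfl, rfl⟩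
    exact ⟨i, x.1, y.1, hadj, rfl, rfl⟩
  · rintro ⟨i, x, y, hadj, hx, hy⟩
    exact ⟨i, ⟨x, mem_of_sierpinskiLattice_adj hadj⟩, ⟨y, mem_of_sierpinskiLattice_adj hadj.symm⟩,
      hadj, Subtype.ext hx, Subtype.ext hy⟩

theorem sierpinskiGraph_zero : sierpinskiGraph 0 = ⊤ := by
  ext ⟨v, hv⟩ ⟨w, hw⟩
  change (sierpinskiLattice 0).Adj v w ↔ _
  simp only [sierpinskiVertices, Finset.mem_insert, Finset.mem_singleton] at hv hw
  rcases hv with rfl | rfl | rfl <;> rcases hw with rfl | rfl | rfl <;>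
    simp [sierpinskiLattice]

theorem sierpinskiCorner_zero_bijective : Function.Bijective (sierpinskiCorner 0) := by
  refine ⟨(isCornerGluing_sierpinskiCopy 0).injective, ?_⟩
  rintro ⟨v, hv⟩
  have hv' := hv
  simp only [sierpinskiVertices, Finset.mem_insert, Finset.mem_singleton] at hv'
  rcases hv' with rfl | rfl | rfl
  exacts [⟨0, rfl⟩, ⟨1, rfl⟩, ⟨2, rfl⟩]

theorem card_sierpinskiVertices (n : ℕ) :
    2 * (sierpinskiVertices n).card = 3 ^ (n + 1) + 3 := by
  induction n with
  | zero => rfl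
  | succ n ih =>
    have := (isCornerGluing_sierpinskiCopy n).card_add_three
    simp only [Nat.card_eq_fintype_card, Fintype.card_coe] at this
    rw [pow_succ]
    omega

end Sierpinski

/-! ### Closed forms and the growth constant -/

section ClosedForms

/-- The numbers `2 ^ a * 3 ^ b * 5 ^ c` with real exponents. -/
noncomputable def rpow235 (a b c : ℝ) : ℝ := (2 : ℝ) ^ a * (3 : ℝ) ^ b * (5 : ℝ) ^ c

theorem rpow235_mul (a b c a' b' c' : ℝ) :
    rpow235 a b c * rpow235 a' b' c' = rpow235 (a + a') (b + b') (c + c') := by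
  simp only [rpow235]
  rw [Real.rpow_add two_pos, Real.rpow_add three_pos, Real.rpow_add (by norm_num : (0 : ℝ) < 5)]
  ring

theorem log_rpow235 (a b c : ℝ) :
    Real.log (rpow235 a b c) = a * Real.log 2 + b * Real.log 3 + c * Real.log 5 := by
  rw [rpow235, Real.log_mul (by positivity) (by positivity),
    Real.log_mul (by positivity) (by positivity), Real.log_rpow two_pos, Real.log_rpow three_pos,
    Real.log_rpow (by norm_num)]

/-- The number of spanning forests of `Γ_n` of a corner type with `k` classes. -/
noncomputable def forestFormula (n k : ℕ) : ℝ :=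
  if k = 1 then
    rpow235 (((3 : ℝ) ^ n - 1) / 2) (((3 : ℝ) ^ (n + 1) + 2 * n + 1) / 4)
      (((3 : ℝ) ^ n - 2 * n - 1) / 4)
  else if k = 2 then
    rpow235 (((3 : ℝ) ^ n - 1) / 2) (((3 : ℝ) ^ (n + 1) - 2 * n - 3) / 4)
      (((3 : ℝ) ^ n + 2 * n - 1) / 4)
  else
    rpow235 (((3 : ℝ) ^ n - 1) / 2) (((3 : ℝ) ^ (n + 1) - 6 * n - 3) / 4)
      (((3 : ℝ) ^ n + 6 * n - 1) / 4)

/-- The invariant that merges the two terms of the recursions for two and three classes. -/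
theorem forestFormula_one_mul_three (n : ℕ) :
    forestFormula n 1 * forestFormula n 3 = 3 * forestFormula n 2 ^ 2 := by
  -- With constants also written as `rpow235`, the identity reduces to one linear identity per
  -- exponent.
  have h3 : (3 : ℝ) = rpow235 0 1 0 := by simp [rpow235]
  rw [h3]
  simp only [forestFormula]
  norm_num only [if_true, if_false, sq, rpow235_mul]
  congr 1 <;> ring

theorem forestFormula_succ_one (n : ℕ) :
    forestFormula (n + 1) 1 = 6 * (forestFormula n 1 ^ 2 * forestFormula n 2) := by
  have h6 : (6 : ℝ) = rpow235 1 1 0 := by norm_num [rpow235]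
  rw [h6]
  simp only [forestFormula]
  norm_num only [if_true, if_false, sq, rpow235_mul]
  congr 1 <;> push_cast <;> ring

/-- By the invariant the first term is three times the product in the second, and 3 + 7 = 10 = 2 ·
5. -/
theorem forestFormula_succ_two (n : ℕ) :
    forestFormula (n + 1) 2 =
      forestFormula n 1 ^ 2 * forestFormula n 3 +
        7 * (forestFormula n 1 * forestFormula n 2 ^ 2) := by
  have h10 : (10 : ℝ) = rpow235 1 0 1 := by norm_num [rpow235]
  have h : forestFormula (n + 1) 2 = 10 * (forestFormula n 1 * forestFormula n 2 ^ 2) := by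
    rw [h10]
    simp only [forestFormula]
    norm_num only [if_true, if_false, sq, rpow235_mul]
    congr 1 <;> push_cast <;> ring
  rw [h]
  linear_combination -forestFormula n 1 * forestFormula_one_mul_three n

/-- By the invariant the sum is 36 + 14 = 50 = 2 · 5² times a cube. -/
theorem forestFormula_succ_three (n : ℕ) :
    forestFormula (n + 1) 3 =
      12 * (forestFormula n 1 * forestFormula n 2 * forestFormula n 3) +
        14 * forestFormula n 2 ^ 3 := by
  have h50 : (50 : ℝ) = rpow235 1 0 2 := by norm_num [rpow235]
  have h : forestFormula (n + 1) 3 = 50 * forestFormula n 2 ^ 3 := by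
    rw [h50]
    simp only [forestFormula]
    norm_num only [if_true, if_false, pow_three, rpow235_mul]
    congr 1 <;> push_cast <;> ring
  rw [h]
  linear_combination -12 * forestFormula n 2 * forestFormula_one_mul_three n

theorem numClasses_cases (t : Fin 5) : t = 0 ∨ numClasses t = 2 ∨ t = 4 := by
  revert t
  decide

/-- All five types are treated in one induction because the recursions mix them. -/
theorem numCornerForests_sierpinskiGraph (n : ℕ) (t : Fin 5) :
    (numCornerForests (sierpinskiCorner n) (sierpinskiGraph n) t : ℝ) =
      forestFormula n (numClasses t) := by
  induction n generalizing t with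
  | zero =>
    rw [sierpinskiGraph_zero, numCornerForests_of_bijective sierpinskiCorner_zero_bijective]
    rcases numClasses_cases t with rfl | h | rfl
    · norm_num [numClasses, forestFormula, rpow235]
    · norm_num [h, forestFormula, rpow235]
    · norm_num [show numClasses 4 = 3 from rfl, forestFormula, rpow235]
  | succ n ih =>
    obtain ⟨w, hw⟩ : ∃ w : ℕ → ℕ, ∀ t,
        numCornerForests (sierpinskiCorner n) (sierpinskiGraph n) t = w (numClasses t) := by
      -- By the induction hypothesis the formula takes natural values at the class numbers, so its
      -- floor is a natural weight depending only on the number of classes.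
      refine ⟨fun k => ⌊forestFormula n k⌋₊, fun t => ?_⟩
      simp only [← ih, Nat.floor_natCast]
    have hf : ∀ t, (w (numClasses t) : ℝ) = forestFormula n (numClasses t) := fun t => by
      rw [← hw, ih]
    have h1 : (w 1 : ℝ) = forestFormula n 1 := hf 0
    have h2 : (w 2 : ℝ) = forestFormula n 2 := hf 1
    have h3 : (w 3 : ℝ) = forestFormula n 3 := hf 4
    have hrec := (isCornerGluing_sierpinskiCopy n).numCornerForests_eq_sum (sierpinskiGraph n) hw t
    rw [glueGraph_sierpinskiGraph, sierpinskiCopy_corner] at hrec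
    rw [hrec]
    rcases numClasses_cases t with rfl | h | rfl
    · rw [sum_gluesTo_zero, show numClasses 0 = 1 from rfl, forestFormula_succ_one, ← h1, ← h2]
      push_cast
      rfl
    · rw [sum_gluesTo_two w h, h, forestFormula_succ_two, ← h1, ← h2, ← h3]
      push_cast
      rfl
    · rw [sum_gluesTo_four, show numClasses 4 = 3 from rfl, forestFormula_succ_three, ← h1, ← h2,
        ← h3]
      push_cast
      rfl

theorem numSpanningTrees_sierpinskiGraph (n : ℕ) :
    (numSpanningTrees (sierpinskiGraph n) : ℝ) = forestFormula n 1 := by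
  rw [numSpanningTrees_eq_numCornerForests (b := sierpinskiCorner n),
    numCornerForests_sierpinskiGraph]
  rfl

theorem sierpinskiTwoForests_eq (n : ℕ) {i j k : Fin 3} (hij : i ≠ j) (hik : i ≠ k)
    (hjk : j ≠ k) : (sierpinskiTwoForests n i j k : ℝ) = forestFormula n 2 := by
  rw [← numClasses_succ k, ← numCornerForests_sierpinskiGraph, sierpinskiTwoForests,
    numCornerForests]
  congr 2
  ext H
  have := isSpanningForest_and_reachable_iff (b := sierpinskiCorner n) (G := sierpinskiGraph n)
    (H := H) (t := k.succ.castSucc)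
  rw [numClasses_succ] at this
  exact (and_congr_right fun _ => reachable_corners_two_iff hij hik hjk).trans this

theorem sierpinskiThreeForests_eq (n : ℕ) :
    (sierpinskiThreeForests n : ℝ) = forestFormula n 3 := by
  rw [show 3 = numClasses 4 from rfl, ← numCornerForests_sierpinskiGraph, sierpinskiThreeForests,
    numCornerForests]
  congr 2
  ext H
  exact (and_congr_right fun _ => reachable_corners_three_iff).trans
    (isSpanningForest_and_reachable_iff (b := sierpinskiCorner n) (G := sierpinskiGraph n)
      (H := H) (t := 4))

theorem tendsto_log_numSpanningTrees_div_card :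
    Tendsto
      (fun n : ℕ => Real.log (numSpanningTrees (sierpinskiGraph n) : ℝ) /
        ((sierpinskiVertices n).card : ℝ))
      atTop (𝓝 (1 / 3 * Real.log 2 + 1 / 2 * Real.log 3 + 1 / 6 * Real.log 5)) := by
  have hu : Tendsto (fun n : ℕ => ((3 : ℝ) ^ n)⁻¹) atTop (𝓝 0) :=
    tendsto_inv_atTop_zero.comp (tendsto_pow_atTop_atTop_of_one_lt (by norm_num))
  have hv : Tendsto (fun n : ℕ => (n : ℝ) * ((3 : ℝ) ^ n)⁻¹) atTop (𝓝 0) := by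
    simpa [div_eq_mul_inv] using
      tendsto_pow_const_div_const_pow_of_one_lt 1 (by norm_num : (1 : ℝ) < 3)
  -- Numerator and denominator are divided by `3 ^ n`, which leaves only the null sequences `hu` and
  -- `hv`.
  have key : ∀ n : ℕ, Real.log (numSpanningTrees (sierpinskiGraph n) : ℝ) /
      ((sierpinskiVertices n).card : ℝ) =
      ((1 - ((3 : ℝ) ^ n)⁻¹) / 2 * Real.log 2 +
        (3 + 2 * ((n : ℝ) * ((3 : ℝ) ^ n)⁻¹) + ((3 : ℝ) ^ n)⁻¹) / 4 * Real.log 3 +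
        (1 - 2 * ((n : ℝ) * ((3 : ℝ) ^ n)⁻¹) - ((3 : ℝ) ^ n)⁻¹) / 4 * Real.log 5) /
      ((3 + 3 * ((3 : ℝ) ^ n)⁻¹) / 2) := by
    intro n
    have hc : ((sierpinskiVertices n).card : ℝ) = ((3 : ℝ) ^ (n + 1) + 3) / 2 := by
      rw [eq_div_iff two_ne_zero, mul_comm]
      exact_mod_cast card_sierpinskiVertices n
    rw [hc, numSpanningTrees_sierpinskiGraph, forestFormula, if_pos rfl, log_rpow235, pow_succ]
    have h3 : (0 : ℝ) < (3 : ℝ) ^ n := by positivity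
    generalize (3 : ℝ) ^ n = x at h3
    field_simp
  simp only [key]
  have h2 := (((tendsto_const_nhds (x := (1 : ℝ))).sub hu).div_const 2).mul_const (Real.log 2)
  have h3 := ((((hv.const_mul 2).const_add 3).add hu).div_const 4).mul_const (Real.log 3)
  have h5 := ((((tendsto_const_nhds (x := (1 : ℝ))).sub (hv.const_mul 2)).sub hu).div_const
    4).mul_const (Real.log 5)
  have hd := ((hu.const_mul 3).const_add 3).div_const 2
  -- The coefficients 1/2, 3/4, 1/4 divided by 3/2, in the shape produced by the limit rules.
  rw [show 1 / 3 * Real.log 2 + 1 / 2 * Real.log 3 + 1 / 6 * Real.log 5 =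
    ((1 - 0) / 2 * Real.log 2 + (3 + 2 * 0 + 0) / 4 * Real.log 3 +
      (1 - 2 * 0 - 0) / 4 * Real.log 5) / ((3 + 3 * 0) / 2) by ring]
  exact ((h2.add h3).add h5).div hd (by norm_num)

end ClosedForms

theorem mainTheorem6 :
    (∀ n : ℕ, 1 ≤ n →
      ((numSpanningTrees (sierpinskiGraph n) : ℝ) =
        (2 : ℝ) ^ (((3 : ℝ) ^ n - 1) / 2) *
        (3 : ℝ) ^ (((3 : ℝ) ^ (n + 1) + 2 * (n : ℝ) + 1) / 4) *
        (5 : ℝ) ^ (((3 : ℝ) ^ n - 2 * (n : ℝ) - 1) / 4)) ∧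
      (∀ i j k : Fin 3, i ≠ j → i ≠ k → j ≠ k →
        (sierpinskiTwoForests n i j k : ℝ) =
          (2 : ℝ) ^ (((3 : ℝ) ^ n - 1) / 2) *
          (3 : ℝ) ^ (((3 : ℝ) ^ (n + 1) - 2 * (n : ℝ) - 3) / 4) *
          (5 : ℝ) ^ (((3 : ℝ) ^ n + 2 * (n : ℝ) - 1) / 4)) ∧
      ((sierpinskiThreeForests n : ℝ) =
        (2 : ℝ) ^ (((3 : ℝ) ^ n - 1) / 2) *
        (3 : ℝ) ^ (((3 : ℝ) ^ (n + 1) - 6 * (n : ℝ) - 3) / 4) *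
        (5 : ℝ) ^ (((3 : ℝ) ^ n + 6 * (n : ℝ) - 1) / 4))) ∧
    Tendsto
      (fun n : ℕ => Real.log (numSpanningTrees (sierpinskiGraph n) : ℝ) /
        ((sierpinskiVertices n).card : ℝ))
      atTop (𝓝 (1 / 3 * Real.log 2 + 1 / 2 * Real.log 3 + 1 / 6 * Real.log 5)) := by
  refine ⟨fun n _ => ⟨numSpanningTrees_sierpinskiGraph n, fun i j k hij hik hjk =>
    sierpinskiTwoForests_eq n hij hik hjk, sierpinskiThreeForests_eq n⟩,
    tendsto_log_numSpanningTrees_div_card⟩
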